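/- Let $q$ be a complex number with $0<|q|<1$. Write $(x)_\infty=(x;q)_\infty=\prod_{j\ge 0}(1-xq^j)$ and, for $k\in\mathbb Z$, let $(x)_k=(x;q)_k=(x;q)_\infty/(xq^k;q)_\infty$, i.e. $(x)_n=\prod_{j=0}^{n-1}(1-xq^j)$ and $(x)_{-n}=\prod_{j=1}^{n}(1-xq^{-j})^{-1}$ for $n\ge 0$; put $(x_1,\dots,x_m)_k=(x_1)_k\cdots(x_m)_k$ for $k$ an integer or $\infty$, and $${}_s\psi_s\!\left[\begin{matrix}a_1,\dots,a_s\\ b_1,\dots,b_s\end{matrix};q,z\right]=\sum_{k=-\infty}^{\infty}\frac{(a_1,\dots,a_s)_k}{(b_1,\dots,b_s)_k}\,z^k .$$ Let $a,b,c,d,e,f$ be nonzero complex numbers, let $\lambda=qa^2/(bcd)$, and let $\sqrt a,\sqrt\lambda$ be any square roots of $a$ and $\lambda$. Assume $|qa^2/(cdef)|<1$ and that no denominator vanishes in the identity below; that is, in each of the two series no upper parameter is of the form $q^{n+1}$ and no lower parameter is of the form $q^{-n}$ with $n\in\{0,1,2,\dots\}$, and the denominator of the infinite product factor is nonzero. Then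 both series converge absolutely and $${}_6\psi_6\!\left[\begin{matrix}q\sqrt a,-q\sqrt a,c,d,e,f\\ \sqrt a,-\sqrt a,aq/c,aq/d,aq/e,aq/f\end{matrix};q,\frac{qa^2}{cdef}\right]$$ $$=\frac{(aq,\;q/a,\;aq/(ef),\;aq/(cd),\;\lambda q/e,\;\lambda q/f,\;aq/(\lambda c),\;aq/(\lambda d))_\infty}{(aq/e,\;aq/f,\;q/c,\;q/d,\;\lambda q,\;q/\lambda,\;\lambda q/(ef),\;b)_\infty}$$ $$\times\;{}_6\psi_6\!\left[\begin{matrix}q\sqrt\lambda,-q\sqrt\lambda,\lambda c/a,\lambda d/a,e,f\\ \sqrt\lambda,-\sqrt\lambda,aq/c,aq/d,\lambda q/e,\lambda q/f\end{matrix};q,\frac{qa^2}{cdef}\right].$$ -/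

import Mathlib

/-- The infinite `q`-shifted factorial `(a; q)_∞ = ∏_{j ≥ 0} (1 - a q^j)`. -/
noncomputable def qPochInf (q a : ℂ) : ℂ := ∏' j : ℕ, (1 - a * q ^ j)

/-- The `q`-shifted factorial `(a; q)_k` for an integer `k`, written out as a finite product:
`(a; q)_n = ∏_{0 ≤ j < n} (1 - a q^j)` and
`(a; q)_{-n} = 1 / ∏_{1 ≤ j ≤ n} (1 - a q^{-j})` for `n ≥ 0`.
It is `(a; q)_∞ / (a q^k; q)_∞` whenever the denominator does not vanish
(`qPoch_eq_div` below). -/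
noncomputable def qPoch (q a : ℂ) : ℤ → ℂ
  | Int.ofNat n => ∏ j ∈ Finset.range n, (1 - a * q ^ j)
  | Int.negSucc n => (∏ j ∈ Finset.range (n + 1), (1 - a * q ^ (-((j : ℤ) + 1))))⁻¹

/-- `(a_1, …, a_m; q)_∞ = (a_1; q)_∞ ⋯ (a_m; q)_∞`. -/
noncomputable def qPochInfs {m : ℕ} (q : ℂ) (a : Fin m → ℂ) : ℂ := ∏ i, qPochInf q (a i)

/-- `(a_1, …, a_m; q)_k = (a_1; q)_k ⋯ (a_m; q)_k`, for an integer `k`. -/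
noncomputable def qPochs {m : ℕ} (q : ℂ) (a : Fin m → ℂ) (k : ℤ) : ℂ := ∏ i, qPoch q (a i) k

/-- The `k`-th term of the bilateral basic hypergeometric series `ₛψₛ[a; b; q, z]`. -/
noncomputable def psiTerm {s : ℕ} (q : ℂ) (a b : Fin s → ℂ) (z : ℂ) (k : ℤ) : ℂ :=
  qPochs q a k / qPochs q b k * z ^ k

/-- The bilateral basic hypergeometric series `ₛψₛ[a; b; q, z]`. -/
noncomputable def psi {s : ℕ} (q : ℂ) (a b : Fin s → ℂ) (z : ℂ) : ℂ :=
  ∑' k : ℤ, psiTerm q a b z k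

/-- No term of `ₛψₛ[a; b; q, z]` has a vanishing denominator: no upper parameter is one of
`q, q², q³, …` (these give poles of `(a_i; q)_k` for `k < 0`), and no lower parameter is one of
`1, q⁻¹, q⁻², …` (these give zeros of `(b_i; q)_k` for `k > 0`). -/
def PsiWellDefined {s : ℕ} (q : ℂ) (a b : Fin s → ℂ) : Prop :=
  (∀ i, ∀ n : ℕ, a i ≠ q ^ (n + 1)) ∧ (∀ i, ∀ n : ℕ, b i * q ^ n ≠ 1)

/-- The product that defines `(a; q)_∞` converges for `|q| < 1`. -/
theorem multipliable_qPochInf {q : ℂ} (hq : ‖q‖ < 1) (a : ℂ) :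
    Multipliable fun j : ℕ => 1 - a * q ^ j := by
  have h : Summable fun j : ℕ => ‖-(a * q ^ j)‖ := by
    simp only [norm_neg, norm_mul, norm_pow]
    exact (summable_geometric_of_lt_one (norm_nonneg q) hq).mul_left _
  simpa [sub_eq_add_neg] using multipliable_one_add_of_summable h

theorem qPochInf_split {q : ℂ} (hq : ‖q‖ < 1) (a : ℂ) (n : ℕ) :
    qPochInf q a = (∏ j ∈ Finset.range n, (1 - a * q ^ j)) * qPochInf q (a * q ^ n) := by
  induction n with
  | zero => simp
  | succ n ih =>
    have h : qPochInf q (a * q ^ n) = (1 - a * q ^ n) * qPochInf q (a * q ^ (n + 1)) := by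
      have h1 := (multipliable_qPochInf hq (a * q ^ (n + 1)))
      unfold qPochInf
      rw [tprod_eq_zero_mul' (by
        refine h1.congr fun j => ?_
        ring)]
      congr 1
      · simp
      · refine tprod_congr fun j => ?_
        ring
    rw [ih, h, Finset.prod_range_succ]
    ring

/-- `(a; q)_k = (a; q)_∞ / (a q^k; q)_∞` for every integer `k`. -/
theorem qPoch_eq_div {q : ℂ} (hq0 : q ≠ 0) (hq : ‖q‖ < 1) (a : ℂ) (k : ℤ)
    (h : qPochInf q (a * q ^ k) ≠ 0) :
    qPoch q a k = qPochInf q a / qPochInf q (a * q ^ k) := by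
  cases k with
  | ofNat n =>
    have h' : qPochInf q (a * q ^ n) ≠ 0 := by simpa using h
    have := qPochInf_split hq a n
    simp only [qPoch, Int.ofNat_eq_natCast, zpow_natCast]
    rw [eq_div_iff h', this]
  | negSucc n =>
    have hs := qPochInf_split hq (a * q ^ (Int.negSucc n)) (n + 1)
    have e : a * q ^ (Int.negSucc n) * q ^ (n + 1) = a := by
      rw [zpow_negSucc, mul_assoc, inv_mul_cancel₀ (pow_ne_zero _ hq0), mul_one]
    have hp : ∏ j ∈ Finset.range (n + 1), (1 - a * q ^ (Int.negSucc n) * q ^ j)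
        = ∏ j ∈ Finset.range (n + 1), (1 - a * q ^ (-((j : ℤ) + 1))) := by
      rw [← Finset.prod_range_reflect]
      refine Finset.prod_congr rfl fun j hj => ?_
      have hj' : j < n + 1 := Finset.mem_range.mp hj
      rw [mul_assoc, ← zpow_natCast q (n + 1 - 1 - j), ← zpow_add₀ hq0]
      congr 3
      rw [Int.negSucc_eq]
      omega
    rw [e, hp] at hs
    rw [hs] at h ⊢
    have h1 := left_ne_zero_of_mul h
    have h2 := right_ne_zero_of_mul h
    simp only [qPoch]
    field_simp

/-! Both series are very-well-poised `₆ψ₆` series with the same argument, one with base `a`, the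
other with base `λ`. Bailey's summation (`bailey_six_psi_six`) turns each into an infinite product,
and the transformation is the quotient of the two products. The weight of the proof is thus Bailey's
sum.

In terms of the inverses `α, β, γ, δ` of the four free parameters, with `1 - a` cleared, the sum and
its value at `αq` are proportional: their combination telescopes over `ℤ` (`wpTerm_telescope`,
`wpSum_step`). Iterating `α → αq → αq² → ⋯ → 0` gives an infinite product times the sum at `α = 0`
(`wpSum_eq_zero_left`). The sum is symmetric in its parameters, so all four can be sent to `0`
(`wpSum_eq_wpSum_zero`).

The remaining constant depends on `a` and `q` alone. The same formula, read at `α = 1/a`, `β = 1`,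
`γ = δ = 0`, where only the term `k = 0` survives, determines it (`wpSum_zero`). -/

/-! ### Well-poised factors: recurrence in `k` and contiguity in `α` -/

/-- `(1/α; q)_k α^k / (aqα; q)_k`, written so that it also makes sense for `α = 0`. -/
noncomputable def wpFactor (q a α : ℂ) : ℤ → ℂ
  | Int.ofNat n => ∏ j ∈ Finset.range n, (α - q ^ j) / (1 - a * α * q ^ (j + 1))
  | Int.negSucc n => ∏ j ∈ Finset.range (n + 1), (q ^ (j + 1) - a * α * q) / (α * q ^ (j + 1) - 1)

/-- No denominator of `wpFactor q a α` vanishes. -/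
def WpRegular (q a α : ℂ) : Prop :=
  ∀ n : ℕ, 1 - α * q ^ (n + 1) ≠ 0 ∧ 1 - a * α * q ^ (n + 1) ≠ 0

theorem WpRegular.zero (q a : ℂ) : WpRegular q a 0 := fun n => by simp

theorem WpRegular.mul_pow {q a α : ℂ} (h : WpRegular q a α) (N : ℕ) :
    WpRegular q a (α * q ^ N) := fun n => by
  have := h (N + n)
  constructor
  · convert this.1 using 2; ring
  · convert this.2 using 2; ring

theorem wpFactor_natCast (q a α : ℂ) (n : ℕ) :
    wpFactor q a α n = ∏ j ∈ Finset.range n, (α - q ^ j) / (1 - a * α * q ^ (j + 1)) := rfl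

theorem wpFactor_zero (q a α : ℂ) : wpFactor q a α 0 = 1 :=
  (wpFactor_natCast q a α 0).trans (by simp)

theorem wpFactor_neg_natCast (q a α : ℂ) (n : ℕ) :
    wpFactor q a α (-(n : ℤ)) =
      ∏ j ∈ Finset.range n, (q ^ (j + 1) - a * α * q) / (α * q ^ (j + 1) - 1) := by
  cases n with
  | zero => simp [wpFactor_zero]
  | succ n => rfl

/-- Cleared of denominators, one recurrence serves both signs of `k`; contiguity and telescoping use
nothing else about the factor. -/
theorem wpFactor_add_one {q a α : ℂ} (hq : q ≠ 0) (h : WpRegular q a α) (k : ℤ) :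
    wpFactor q a α (k + 1) * (1 - a * α * q ^ (k + 1)) = wpFactor q a α k * (α - q ^ k) := by
  have hnat : ∀ n : ℕ, wpFactor q a α ((n : ℤ) + 1) * (1 - a * α * q ^ ((n : ℤ) + 1)) =
      wpFactor q a α n * (α - q ^ (n : ℤ)) := fun n => by
    have e : (n : ℤ) + 1 = ((n + 1 : ℕ) : ℤ) := by push_cast; rfl
    rw [e, wpFactor_natCast, wpFactor_natCast, Finset.prod_range_succ, zpow_natCast, zpow_natCast,
      mul_assoc, div_mul_cancel₀ _ (h n).2]
  obtain ⟨n, rfl | rfl⟩ := k.eq_nat_or_neg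
  · exact hnat n
  · cases n with
    | zero => simpa using hnat 0
    | succ n =>
      have h1' : α * q ^ (n + 1) - 1 ≠ 0 := fun h0 => (h n).1 (by linear_combination -h0)
      have e : (-((n + 1 : ℕ) : ℤ)) + 1 = -(n : ℤ) := by push_cast; ring
      rw [e, wpFactor_neg_natCast, wpFactor_neg_natCast, Finset.prod_range_succ, zpow_neg, zpow_neg,
        zpow_natCast, zpow_natCast]
      have hp : q ^ n ≠ 0 := pow_ne_zero _ hq
      refine Eq.trans ?_ (mul_assoc _ _ _).symm
      congr 1
      field_simp
      ring

/-- The contiguity relation between the parameters `α` and `qα`. -/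
theorem wpFactor_contiguous {q a α : ℂ} (hq : q ≠ 0) (h : WpRegular q a α) (k : ℤ) :
    wpFactor q a α k * (1 - α * q) * (1 - a * α * q) * q ^ k =
      wpFactor q a (α * q) k * (q ^ k - α * q) * (1 - a * α * q * q ^ k) := by
  have hα : WpRegular q a (α * q) := by simpa using h.mul_pow 1
  induction k with
  | zero => simp [wpFactor_zero]
  | succ n ih =>
    have s₁ := wpFactor_add_one hq h n
    have s₂ := wpFactor_add_one hq hα n
    have hD : 1 - a * α * q ^ ((n : ℤ) + 1) ≠ 0 := by exact_mod_cast (h n).2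
    refine mul_right_cancel₀ hD ?_
    rw [zpow_add_one₀ hq] at *
    linear_combination (1 - α * q) * (1 - a * α * q) * (q ^ (n : ℤ) * q) * s₁ +
      q * (α - q ^ (n : ℤ)) * ih -
      (q ^ (n : ℤ) * q - α * q) * (1 - a * α * (q ^ (n : ℤ) * q)) * s₂
  | pred n ih =>
    obtain ⟨k, hk⟩ : ∃ k : ℤ, k = -(n : ℤ) - 1 := ⟨_, rfl⟩
    have hk1 : -(n : ℤ) = k + 1 := by omega
    have s₁ := wpFactor_add_one hq h k
    have s₂ := wpFactor_add_one hq hα k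
    -- Here `k = -(n + 1)`, so `α = q ^ k` would mean `α q^(n+1) = 1`, which regularity excludes.
    have hD : α - q ^ k ≠ 0 := fun h0 => (h n).1 (by
      have e : q ^ k * q ^ (n + 1) = 1 := by
        rw [← zpow_natCast, ← zpow_add₀ hq, hk]
        simp
      rw [sub_eq_zero.1 h0, e, sub_self])
    rw [← hk]
    rw [hk1] at ih
    refine mul_right_cancel₀ (mul_ne_zero hD hq) ?_
    rw [zpow_add_one₀ hq] at *
    linear_combination -(1 - α * q) * (1 - a * α * q) * (q ^ k * q) * s₁ +
      (1 - a * α * (q ^ k * q)) * ih +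
      (q ^ k * q - α * q) * (1 - a * α * (q ^ k * q)) * s₂

/-! ### Uniform bounds for finite `q`-products -/

theorem tendsto_qPoch_natCast {q : ℂ} (hq : ‖q‖ < 1) (x : ℂ) :
    Filter.Tendsto (fun n : ℕ => ∏ j ∈ Finset.range n, (1 - x * q ^ j)) Filter.atTop
      (nhds (qPochInf q x)) :=
  (multipliable_qPochInf hq x).hasProd.tendsto_prod_nat

theorem qPochInf_ne_zero_iff {q : ℂ} (hq : ‖q‖ < 1) {x : ℂ} :
    qPochInf q x ≠ 0 ↔ ∀ n : ℕ, 1 - x * q ^ n ≠ 0 := by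
  constructor
  · intro h n h0
    apply h
    rw [qPochInf_split hq x (n + 1), Finset.prod_range_succ, h0]
    simp
  · intro h
    have := tprod_one_add_ne_zero_of_summable (f := fun j : ℕ => -(x * q ^ j))
      (by simpa [sub_eq_add_neg] using h)
      (by
        simp only [norm_neg, norm_mul, norm_pow]
        exact (summable_geometric_of_lt_one (norm_nonneg q) hq).mul_left _)
    simpa [qPochInf, sub_eq_add_neg] using this

/-- The inverses of the products `∏_{N ≤ j < N + k} (1 - x q^j)` are bounded. -/
theorem exists_norm_inv_prod_le {q : ℂ} (hq : ‖q‖ < 1) {x : ℂ}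
    (hx : ∀ n : ℕ, 1 - x * q ^ n ≠ 0) :
    ∃ C : ℝ, 0 < C ∧ ∀ N k : ℕ, ‖(∏ j ∈ Finset.range k, (1 - x * q ^ (N + j)))⁻¹‖ ≤ C := by
  have ht := tendsto_qPoch_natCast hq x
  obtain ⟨A, hA⟩ := ht.norm.bddAbove_range
  obtain ⟨B, hB⟩ := (ht.inv₀ ((qPochInf_ne_zero_iff hq).2 hx)).norm.bddAbove_range
  have hA' := fun n => hA (Set.mem_range_self n)
  have hB' := fun n => hB (Set.mem_range_self n)
  have hA0 : 0 < A := lt_of_lt_of_le (by simp) (hA' 0)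
  have hB0 : 0 < B := lt_of_lt_of_le (by simp) (hB' 0)
  refine ⟨A * B, by positivity, fun N k => ?_⟩
  have hN : ∏ j ∈ Finset.range N, (1 - x * q ^ j) ≠ 0 := Finset.prod_ne_zero_iff.2 fun j _ => hx j
  -- The block is a quotient of two initial products, which converge to a nonzero limit; hence they
  -- and their inverses are bounded.
  have e : (∏ j ∈ Finset.range k, (1 - x * q ^ (N + j)))⁻¹ =
      (∏ j ∈ Finset.range N, (1 - x * q ^ j)) * (∏ j ∈ Finset.range (N + k), (1 - x * q ^ j))⁻¹ := by
    rw [Finset.prod_range_add, mul_inv, mul_inv_cancel_left₀ hN]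
  rw [e, norm_mul]
  exact mul_le_mul (hA' N) (hB' _) (norm_nonneg _) hA0.le

theorem exists_prod_one_add_le {s : ℝ} (hs0 : 0 ≤ s) (hs : s < 1) {t : ℝ} (ht : 0 ≤ t) :
    ∃ C : ℝ, 0 < C ∧ ∀ k : ℕ, ∏ j ∈ Finset.range k, (1 + t * s ^ j) ≤ C := by
  refine ⟨Real.exp (t * (1 - s)⁻¹), Real.exp_pos _, fun k => ?_⟩
  calc ∏ j ∈ Finset.range k, (1 + t * s ^ j)
      ≤ ∏ j ∈ Finset.range k, Real.exp (t * s ^ j) :=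
        Finset.prod_le_prod (fun j _ => by positivity) fun j _ => by
          rw [add_comm]; exact Real.add_one_le_exp _
    _ = Real.exp (t * ∑ j ∈ Finset.range k, s ^ j) := by
        rw [← Real.exp_sum, Finset.mul_sum]
    _ ≤ _ := by
        rw [← tsum_geometric_of_lt_one hs0 hs]
        gcongr
        exact (summable_geometric_of_lt_one hs0 hs).sum_le_tsum _ fun j _ => by positivity

/-- Pulling `r` (or `‖a‖ ‖q‖ r`) out of every numerator factor leaves a product of `1 + t ‖q‖^j`,
which is bounded. The constant does not depend on `N`, as dominated convergence for `α q^N → 0` will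
require. A radius `r` replaces `‖α‖` because `α` may vanish. -/
theorem exists_norm_wpFactor_le {q a α : ℂ} (hq0 : q ≠ 0) (hq : ‖q‖ < 1) (ha : a ≠ 0)
    (h : WpRegular q a α) {r : ℝ} (hr : 0 < r) (hαr : ‖α‖ ≤ r) :
    ∃ C : ℝ, 0 < C ∧ ∀ N k : ℕ, ‖wpFactor q a (α * q ^ N) k‖ ≤ C * r ^ k ∧
      ‖wpFactor q a (α * q ^ N) (-(k : ℤ))‖ ≤ C * (‖a‖ * ‖q‖ * r) ^ k := by
  have hqp : 0 < ‖q‖ := norm_pos_iff.2 hq0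
  have hap : 0 < ‖a‖ := norm_pos_iff.2 ha
  obtain ⟨C₁, hC₁, h₁⟩ := exists_norm_inv_prod_le hq (x := a * α * q)
    (fun n => by have := (h n).2; convert this using 2; ring)
  obtain ⟨C₂, hC₂, h₂⟩ := exists_norm_inv_prod_le hq (x := α * q)
    (fun n => by have := (h n).1; convert this using 2; ring)
  obtain ⟨D₁, hD₁, hd₁⟩ := exists_prod_one_add_le hqp.le hq (t := r⁻¹) (by positivity)
  obtain ⟨D₂, hD₂, hd₂⟩ := exists_prod_one_add_le hqp.le hq (t := (‖a‖ * r)⁻¹) (by positivity)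
  have hαN : ∀ N : ℕ, ‖α * q ^ N‖ ≤ r := fun N => by
    rw [norm_mul, norm_pow]
    exact (mul_le_of_le_one_right (norm_nonneg _) (pow_le_one₀ hqp.le hq.le)).trans hαr
  refine ⟨D₁ * C₁ + D₂ * C₂, by positivity, fun N k => ⟨?_, ?_⟩⟩
  · rw [wpFactor_natCast, Finset.prod_div_distrib, div_eq_mul_inv, norm_mul]
    have e1 : ∏ j ∈ Finset.range k, (1 - a * (α * q ^ N) * q ^ (j + 1)) =
        ∏ j ∈ Finset.range k, (1 - a * α * q * q ^ (N + j)) :=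
      Finset.prod_congr rfl fun j _ => by ring
    have e2 : ‖∏ j ∈ Finset.range k, (α * q ^ N - q ^ j)‖ ≤ r ^ k * D₁ := by
      rw [norm_prod]
      calc _ ≤ ∏ j ∈ Finset.range k, (r * (1 + r⁻¹ * ‖q‖ ^ j)) := by
            refine Finset.prod_le_prod (fun j _ => norm_nonneg _) fun j _ => ?_
            refine (norm_sub_le _ _).trans ?_
            rw [norm_pow, mul_add, mul_one, mul_inv_cancel_left₀ hr.ne']
            gcongr
            exact hαN N
        _ = r ^ k * ∏ j ∈ Finset.range k, (1 + r⁻¹ * ‖q‖ ^ j) := by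
            rw [Finset.prod_mul_distrib]; simp
        _ ≤ _ := by gcongr; exact hd₁ k
    rw [e1]
    calc _ ≤ (r ^ k * D₁) * C₁ := mul_le_mul e2 (h₁ N k) (norm_nonneg _) (by positivity)
      _ ≤ (D₁ * C₁ + D₂ * C₂) * r ^ k := by
        have : 0 ≤ D₂ * C₂ * r ^ k := by positivity
        linarith
  · rw [wpFactor_neg_natCast, Finset.prod_div_distrib, div_eq_mul_inv, norm_mul]
    have e1 : ‖(∏ j ∈ Finset.range k, (α * q ^ N * q ^ (j + 1) - 1))⁻¹‖ =
        ‖(∏ j ∈ Finset.range k, (1 - α * q * q ^ (N + j)))⁻¹‖ := by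
      rw [norm_inv, norm_inv, norm_prod, norm_prod]
      congr 1
      refine Finset.prod_congr rfl fun j _ => ?_
      rw [norm_sub_rev]
      congr 1
      ring
    have e2 : ‖∏ j ∈ Finset.range k, (q ^ (j + 1) - a * (α * q ^ N) * q)‖ ≤
        (‖a‖ * ‖q‖ * r) ^ k * D₂ := by
      rw [norm_prod]
      calc _ ≤ ∏ j ∈ Finset.range k, (‖a‖ * ‖q‖ * r * (1 + (‖a‖ * r)⁻¹ * ‖q‖ ^ j)) := by
            refine Finset.prod_le_prod (fun j _ => norm_nonneg _) fun j _ => ?_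
            refine (norm_sub_le _ _).trans ?_
            have e : ‖a‖ * ‖q‖ * r * (1 + (‖a‖ * r)⁻¹ * ‖q‖ ^ j) =
                ‖q‖ ^ (j + 1) + ‖a‖ * r * ‖q‖ := by
              field_simp
              ring
            rw [e, norm_pow, norm_mul, norm_mul a]
            gcongr
            exact hαN N
        _ = (‖a‖ * ‖q‖ * r) ^ k * ∏ j ∈ Finset.range k, (1 + (‖a‖ * r)⁻¹ * ‖q‖ ^ j) := by
            rw [Finset.prod_mul_distrib]; simp
        _ ≤ _ := by gcongr; exact hd₂ k
    rw [e1]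
    calc _ ≤ ((‖a‖ * ‖q‖ * r) ^ k * D₂) * C₂ := mul_le_mul e2 (h₂ N k) (norm_nonneg _) (by positivity)
      _ ≤ (D₁ * C₁ + D₂ * C₂) * (‖a‖ * ‖q‖ * r) ^ k := by
        have : 0 ≤ D₁ * C₁ * (‖a‖ * ‖q‖ * r) ^ k := by positivity
        linarith

/-! ### The bilateral sum: convergence and the limit `α → 0` -/

/-- The term of the very-well-poised bilateral series with `1 - a` cleared; the parameters are
the inverses of the usual ones, so that they may vanish. -/
noncomputable def wpTerm (q a α β γ δ : ℂ) (k : ℤ) : ℂ :=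
  (1 - a * (q ^ k) ^ 2) * (q * a ^ 2) ^ k *
    (wpFactor q a α k * wpFactor q a β k * wpFactor q a γ k * wpFactor q a δ k)

noncomputable def wpSum (q a α β γ δ : ℂ) : ℂ := ∑' k : ℤ, wpTerm q a α β γ δ k

/-- The strict inequality survives a small enlargement of all four moduli, by continuity. -/
theorem exists_radii {q a α β γ δ : ℂ} (hz : ‖q * a ^ 2 * α * β * γ * δ‖ < 1) :
    ∃ r₁ r₂ r₃ r₄ : ℝ, (0 < r₁ ∧ ‖α‖ ≤ r₁) ∧ (0 < r₂ ∧ ‖β‖ ≤ r₂) ∧ (0 < r₃ ∧ ‖γ‖ ≤ r₃) ∧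
      (0 < r₄ ∧ ‖δ‖ ≤ r₄) ∧ ‖q‖ * ‖a‖ ^ 2 * (r₁ * r₂ * r₃ * r₄) < 1 := by
  have hc : Continuous fun t : ℝ =>
      ‖q‖ * ‖a‖ ^ 2 * ((‖α‖ + t) * (‖β‖ + t) * (‖γ‖ + t) * (‖δ‖ + t)) := by fun_prop
  have h0 : ‖q‖ * ‖a‖ ^ 2 * ((‖α‖ + 0) * (‖β‖ + 0) * (‖γ‖ + 0) * (‖δ‖ + 0)) < 1 := by
    simp only [norm_mul, norm_pow] at hz
    linarith
  have h1 := hc.continuousAt.eventually_lt_const h0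
  obtain ⟨t, ht, ht0⟩ := ((h1.filter_mono nhdsWithin_le_nhds).and
    (self_mem_nhdsWithin (s := Set.Ioi (0 : ℝ)))).exists
  have ht0 : 0 < t := ht0
  exact ⟨‖α‖ + t, ‖β‖ + t, ‖γ‖ + t, ‖δ‖ + t, ⟨by positivity, by linarith⟩,
    ⟨by positivity, by linarith⟩, ⟨by positivity, by linarith⟩, ⟨by positivity, by linarith⟩, ht⟩

theorem summable_pow_natAbs {θ : ℝ} (h0 : 0 ≤ θ) (h1 : θ < 1) (C : ℝ) :
    Summable fun k : ℤ => C * θ ^ k.natAbs := by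
  refine Summable.of_nat_of_neg ?_ ?_ <;>
    simpa using (summable_geometric_of_lt_one h0 h1).mul_left C

theorem norm_mul_four_le {x y z w : ℂ} {A B C D : ℝ} (hx : ‖x‖ ≤ A) (hy : ‖y‖ ≤ B)
    (hz : ‖z‖ ≤ C) (hw : ‖w‖ ≤ D) : ‖x * y * z * w‖ ≤ A * B * C * D := by
  have hA := (norm_nonneg x).trans hx
  have hB := (norm_nonneg y).trans hy
  have hC := (norm_nonneg z).trans hz
  rw [norm_mul, norm_mul, norm_mul]
  gcongr

theorem norm_one_sub_mul_pow_le {q : ℂ} (hq : ‖q‖ < 1) (x : ℂ) (k : ℕ) :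
    ‖1 - x * q ^ k‖ ≤ 1 + ‖x‖ := by
  refine (norm_sub_le _ _).trans ?_
  rw [norm_one, norm_mul, norm_pow]
  gcongr
  exact mul_le_of_le_one_right (norm_nonneg _) (pow_le_one₀ (norm_nonneg _) hq.le)

theorem norm_one_sub_mul_zpow_neg_le {q : ℂ} (hq0 : q ≠ 0) (hq : ‖q‖ < 1) (x : ℂ) (k : ℕ) :
    ‖1 - x * q ^ (-(k : ℤ))‖ ≤ (1 + ‖x‖) * (‖q‖ ^ k)⁻¹ := by
  have hqp : 0 < ‖q‖ := norm_pos_iff.2 hq0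
  refine (norm_sub_le _ _).trans ?_
  rw [norm_one, norm_mul, norm_zpow, zpow_neg, zpow_natCast, add_mul, one_mul]
  gcongr
  exact (one_le_inv₀ (by positivity)).2 (pow_le_one₀ hqp.le hq.le)

/-- The same ratio governs both tails: for negative `k` the powers of `q` and `a` from the four
factors, the prefactor and `1 - a q^(2k)` combine again to `‖q‖ ‖a‖²`. -/
theorem exists_norm_wpTerm_le {q a α β γ δ : ℂ} (hq0 : q ≠ 0) (hq : ‖q‖ < 1) (ha : a ≠ 0)
    (hα : WpRegular q a α) (hβ : WpRegular q a β) (hγ : WpRegular q a γ) (hδ : WpRegular q a δ)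
    (hz : ‖q * a ^ 2 * α * β * γ * δ‖ < 1) :
    ∃ C θ : ℝ, 0 ≤ θ ∧ θ < 1 ∧ ∀ (N : ℕ) (k : ℤ),
      ‖wpTerm q a (α * q ^ N) β γ δ k‖ ≤ C * θ ^ k.natAbs := by
  have hqp : 0 < ‖q‖ := norm_pos_iff.2 hq0
  have hap : 0 < ‖a‖ := norm_pos_iff.2 ha
  obtain ⟨r₁, r₂, r₃, r₄, ⟨hr₁, hα'⟩, ⟨hr₂, hβ'⟩, ⟨hr₃, hγ'⟩, ⟨hr₄, hδ'⟩, hθ⟩ := exists_radii hz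
  obtain ⟨C₁, hC₁, h₁⟩ := exists_norm_wpFactor_le hq0 hq ha hα hr₁ hα'
  obtain ⟨C₂, hC₂, h₂⟩ := exists_norm_wpFactor_le hq0 hq ha hβ hr₂ hβ'
  obtain ⟨C₃, hC₃, h₃⟩ := exists_norm_wpFactor_le hq0 hq ha hγ hr₃ hγ'
  obtain ⟨C₄, hC₄, h₄⟩ := exists_norm_wpFactor_le hq0 hq ha hδ hr₄ hδ'
  refine ⟨(1 + ‖a‖) * (C₁ * C₂ * C₃ * C₄), ‖q‖ * ‖a‖ ^ 2 * (r₁ * r₂ * r₃ * r₄), by positivity, hθ,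
    fun N k => ?_⟩
  obtain ⟨n, rfl | rfl⟩ := k.eq_nat_or_neg
  · have hw := norm_mul_four_le (h₁ N n).1 (h₂ 0 n).1 (h₃ 0 n).1 (h₄ 0 n).1
    simp only [pow_zero, mul_one] at hw
    have hv := norm_one_sub_mul_pow_le hq a (n * 2)
    rw [wpTerm, norm_mul, norm_mul, Int.natAbs_natCast, zpow_natCast, zpow_natCast, norm_pow,
      ← pow_mul]
    refine (mul_le_mul (mul_le_mul_of_nonneg_right hv (by positivity)) hw (norm_nonneg _)
      (by positivity)).trans_eq ?_
    simp only [norm_mul, norm_pow, mul_pow]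
    ring
  · have hw := norm_mul_four_le (h₁ N n).2 (h₂ 0 n).2 (h₃ 0 n).2 (h₄ 0 n).2
    simp only [pow_zero, mul_one] at hw
    have hv := norm_one_sub_mul_zpow_neg_le hq0 hq a (n * 2)
    have e : (q ^ (-(n : ℤ))) ^ 2 = q ^ (-((n * 2 : ℕ) : ℤ)) := by
      rw [← zpow_natCast, ← zpow_mul]; push_cast; ring_nf
    rw [wpTerm, norm_mul, norm_mul, Int.natAbs_neg, Int.natAbs_natCast, e,
      zpow_neg (q * a ^ 2), zpow_natCast, norm_inv, norm_pow]
    refine (mul_le_mul (mul_le_mul_of_nonneg_right hv (by positivity)) hw (norm_nonneg _)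
      (by positivity)).trans_eq ?_
    simp only [norm_mul, norm_pow, mul_pow, pow_mul, pow_right_comm ‖a‖ 2 n]
    field_simp

theorem summable_wpTerm {q a α β γ δ : ℂ} (hq0 : q ≠ 0) (hq : ‖q‖ < 1) (ha : a ≠ 0)
    (hα : WpRegular q a α) (hβ : WpRegular q a β) (hγ : WpRegular q a γ) (hδ : WpRegular q a δ)
    (hz : ‖q * a ^ 2 * α * β * γ * δ‖ < 1) : Summable (wpTerm q a α β γ δ) := by
  obtain ⟨C, θ, h0, h1, h⟩ := exists_norm_wpTerm_le hq0 hq ha hα hβ hγ hδ hz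
  exact (summable_pow_natAbs h0 h1 C).of_norm_bounded fun k => by simpa using h 0 k

theorem tendsto_wpFactor {q : ℂ} (hq : ‖q‖ < 1) (a α : ℂ) (k : ℤ) :
    Filter.Tendsto (fun N : ℕ => wpFactor q a (α * q ^ N) k) Filter.atTop
      (nhds (wpFactor q a 0 k)) := by
  have h0 : Filter.Tendsto (fun N : ℕ => α * q ^ N) Filter.atTop (nhds 0) := by
    simpa using (tendsto_pow_atTop_nhds_zero_of_norm_lt_one hq).const_mul α
  have hc : ContinuousAt (fun x => wpFactor q a x k) 0 := by
    cases k with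
    | ofNat n =>
      simp only [wpFactor]
      refine tendsto_finsetProd _ fun j _ => ?_
      exact ContinuousAt.div (by fun_prop) (by fun_prop) (by simp)
    | negSucc n =>
      simp only [wpFactor]
      refine tendsto_finsetProd _ fun j _ => ?_
      exact ContinuousAt.div (by fun_prop) (by fun_prop) (by simp)
  exact hc.tendsto.comp h0

theorem tendsto_wpSum {q a α β γ δ : ℂ} (hq0 : q ≠ 0) (hq : ‖q‖ < 1) (ha : a ≠ 0)
    (hα : WpRegular q a α) (hβ : WpRegular q a β) (hγ : WpRegular q a γ) (hδ : WpRegular q a δ)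
    (hz : ‖q * a ^ 2 * α * β * γ * δ‖ < 1) :
    Filter.Tendsto (fun N : ℕ => wpSum q a (α * q ^ N) β γ δ) Filter.atTop
      (nhds (wpSum q a 0 β γ δ)) := by
  obtain ⟨C, θ, h0, h1, h⟩ := exists_norm_wpTerm_le hq0 hq ha hα hβ hγ hδ hz
  refine tendsto_tsum_of_dominated_convergence (summable_pow_natAbs h0 h1 C) (fun k => ?_)
    (Filter.Eventually.of_forall fun N k => h N k)
  unfold wpTerm
  exact ((((tendsto_wpFactor hq a α k).mul_const _).mul_const _).mul_const _).const_mul _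

/-! ### Telescoping in `k` and iteration in `α` -/

/-- The telescoping companion of `wpTerm`. -/
noncomputable def wpCert (q a α β γ δ : ℂ) (k : ℤ) : ℂ :=
  (a ^ 2) ^ k *
    (((1 - a * α * q ^ k) * wpFactor q a α k) * ((1 - a * β * q ^ k) * wpFactor q a β k) *
      ((1 - a * γ * q ^ k) * wpFactor q a γ k) * ((1 - a * δ * q ^ k) * wpFactor q a δ k))

/-- The certificate lacks the `q ^ k` of `wpTerm`; taking it at `αq` supplies the missing `‖q‖`, so
the ratio is that of `wpTerm` at `α`. -/
theorem summable_wpCert {q a α β γ δ : ℂ} (hq0 : q ≠ 0) (hq : ‖q‖ < 1) (ha : a ≠ 0)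
    (hα : WpRegular q a α) (hβ : WpRegular q a β) (hγ : WpRegular q a γ) (hδ : WpRegular q a δ)
    (hz : ‖q * a ^ 2 * α * β * γ * δ‖ < 1) : Summable (wpCert q a (α * q) β γ δ) := by
  have hqp : 0 < ‖q‖ := norm_pos_iff.2 hq0
  have hap : 0 < ‖a‖ := norm_pos_iff.2 ha
  obtain ⟨r₁, r₂, r₃, r₄, ⟨hr₁, hα'⟩, ⟨hr₂, hβ'⟩, ⟨hr₃, hγ'⟩, ⟨hr₄, hδ'⟩, hθ⟩ := exists_radii hz
  have hαq : ‖α * q‖ ≤ r₁ * ‖q‖ := by rw [norm_mul]; gcongr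
  have key : ∀ {β : ℂ} {r : ℝ}, WpRegular q a β → 0 < r → ‖β‖ ≤ r → ∃ C : ℝ, ∀ n : ℕ,
      ‖(1 - a * β * q ^ (n : ℤ)) * wpFactor q a β n‖ ≤ C * r ^ n ∧
      ‖(1 - a * β * q ^ (-(n : ℤ))) * wpFactor q a β (-(n : ℤ))‖ ≤ C * (‖a‖ * r) ^ n := by
    intro β r h hr hβr
    obtain ⟨C, hC, hb⟩ := exists_norm_wpFactor_le hq0 hq ha h hr hβr
    refine ⟨(1 + ‖a * β‖) * C, fun n => ⟨?_, ?_⟩⟩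
    · have h1 := (hb 0 n).1
      rw [pow_zero, mul_one] at h1
      rw [norm_mul, zpow_natCast, mul_assoc (1 + ‖a * β‖)]
      exact mul_le_mul (norm_one_sub_mul_pow_le hq _ n) h1 (norm_nonneg _) (by positivity)
    · have h1 := (hb 0 n).2
      rw [pow_zero, mul_one] at h1
      rw [norm_mul]
      refine (mul_le_mul (norm_one_sub_mul_zpow_neg_le hq0 hq _ n) h1 (norm_nonneg _)
        (by positivity)).trans_eq ?_
      simp only [mul_pow]
      field_simp
  obtain ⟨C₁, h₁⟩ := key (by simpa using hα.mul_pow 1) (by positivity) hαq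
  obtain ⟨C₂, h₂⟩ := key hβ hr₂ hβ'
  obtain ⟨C₃, h₃⟩ := key hγ hr₃ hγ'
  obtain ⟨C₄, h₄⟩ := key hδ hr₄ hδ'
  refine (summable_pow_natAbs (by positivity) hθ (C₁ * C₂ * C₃ * C₄)).of_norm_bounded fun k => ?_
  obtain ⟨n, rfl | rfl⟩ := k.eq_nat_or_neg
  · have hw := norm_mul_four_le (h₁ n).1 (h₂ n).1 (h₃ n).1 (h₄ n).1
    rw [wpCert, norm_mul, Int.natAbs_natCast, zpow_natCast, norm_pow]
    refine (mul_le_mul_of_nonneg_left hw (by positivity)).trans_eq ?_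
    simp only [norm_pow, mul_pow]
    ring
  · have hw := norm_mul_four_le (h₁ n).2 (h₂ n).2 (h₃ n).2 (h₄ n).2
    rw [wpCert, norm_mul, Int.natAbs_neg, Int.natAbs_natCast, zpow_neg (a ^ 2), zpow_natCast,
      norm_inv, norm_pow]
    refine (mul_le_mul_of_nonneg_left hw (by positivity)).trans_eq ?_
    simp only [norm_pow, mul_pow, pow_right_comm ‖a‖ 2 n]
    field_simp

/-- The recurrences express the certificate at `k + 1` through factors at `k`, and contiguity
replaces the factor of `α` by that of `αq`. Every term then has the same product of factors, and a
polynomial identity in `q ^ k` remains. -/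
theorem wpTerm_telescope {q a α β γ δ : ℂ} (hq0 : q ≠ 0) (ha : a ≠ 0)
    (hα : WpRegular q a α) (hβ : WpRegular q a β) (hγ : WpRegular q a γ) (hδ : WpRegular q a δ)
    (k : ℤ) :
    (1 - α * q) * (1 - a * α * q) * (1 - q * a ^ 2 * α * β * γ * δ) * wpTerm q a α β γ δ k -
        (1 - a * q * α * β) * (1 - a * q * α * γ) * (1 - a * q * α * δ) *
          wpTerm q a (α * q) β γ δ k =
      α * q * (wpCert q a (α * q) β γ δ (k + 1) - wpCert q a (α * q) β γ δ k) := by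
  have hαq : WpRegular q a (α * q) := by simpa using hα.mul_pow 1
  have hc := wpFactor_contiguous hq0 hα k
  have s₁ := wpFactor_add_one hq0 hαq k
  have s₂ := wpFactor_add_one hq0 hβ k
  have s₃ := wpFactor_add_one hq0 hγ k
  have s₄ := wpFactor_add_one hq0 hδ k
  have e : wpCert q a (α * q) β γ δ (k + 1) = (a ^ 2) ^ (k + 1) *
      ((wpFactor q a (α * q) (k + 1) * (1 - a * (α * q) * q ^ (k + 1))) *
      (wpFactor q a β (k + 1) * (1 - a * β * q ^ (k + 1))) *
      (wpFactor q a γ (k + 1) * (1 - a * γ * q ^ (k + 1))) *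
      (wpFactor q a δ (k + 1) * (1 - a * δ * q ^ (k + 1)))) := by
    rw [wpCert]; ring
  rw [e, s₁, s₂, s₃, s₄, wpCert, wpTerm, wpTerm, mul_zpow, zpow_add_one₀ (pow_ne_zero 2 ha)]
  linear_combination (1 - q * a ^ 2 * α * β * γ * δ) * (1 - a * (q ^ k) ^ 2) * (a ^ 2) ^ k *
    (wpFactor q a β k * wpFactor q a γ k * wpFactor q a δ k) * hc

/-- Summation over all of `ℤ` is shift invariant, so the certificate contributes no boundary term.
-/
theorem wpSum_step {q a α β γ δ : ℂ} (hq0 : q ≠ 0) (hq : ‖q‖ < 1) (ha : a ≠ 0)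
    (hα : WpRegular q a α) (hβ : WpRegular q a β) (hγ : WpRegular q a γ) (hδ : WpRegular q a δ)
    (hz : ‖q * a ^ 2 * α * β * γ * δ‖ < 1) :
    (1 - α * q) * (1 - a * α * q) * (1 - q * a ^ 2 * α * β * γ * δ) * wpSum q a α β γ δ =
      (1 - a * q * α * β) * (1 - a * q * α * γ) * (1 - a * q * α * δ) *
        wpSum q a (α * q) β γ δ := by
  have hzq : ‖q * a ^ 2 * (α * q) * β * γ * δ‖ < 1 := by
    have : q * a ^ 2 * (α * q) * β * γ * δ = q * a ^ 2 * α * β * γ * δ * q := by ring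
    rw [this, norm_mul]
    exact mul_lt_one_of_nonneg_of_lt_one_left (norm_nonneg _) hz hq.le
  have hαq : WpRegular q a (α * q) := by simpa using hα.mul_pow 1
  have t₁ := summable_wpTerm hq0 hq ha hα hβ hγ hδ hz
  have t₂ := summable_wpTerm hq0 hq ha hαq hβ hγ hδ hzq
  have g := summable_wpCert hq0 hq ha hα hβ hγ hδ hz
  have g' : Summable fun k : ℤ => wpCert q a (α * q) β γ δ (k + 1) :=
    (Equiv.addRight (1 : ℤ)).summable_iff.2 g
  have eg : ∑' k : ℤ, wpCert q a (α * q) β γ δ (k + 1) = ∑' k : ℤ, wpCert q a (α * q) β γ δ k :=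
    (Equiv.addRight (1 : ℤ)).tsum_eq (wpCert q a (α * q) β γ δ)
  have h := tsum_congr (L := .unconditional ℤ) (wpTerm_telescope hq0 ha hα hβ hγ hδ)
  rw [(t₁.mul_left _).tsum_sub (t₂.mul_left _), tsum_mul_left, tsum_mul_left, tsum_mul_left,
    g'.tsum_sub g, eg, sub_self, mul_zero] at h
  exact sub_eq_zero.1 h

theorem wpSum_eq_zero_left {q a α β γ δ : ℂ} (hq0 : q ≠ 0) (hq : ‖q‖ < 1) (ha : a ≠ 0)
    (hα : WpRegular q a α) (hβ : WpRegular q a β) (hγ : WpRegular q a γ) (hδ : WpRegular q a δ)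
    (hz : ‖q * a ^ 2 * α * β * γ * δ‖ < 1) :
    qPochInf q (α * q) * qPochInf q (a * α * q) * qPochInf q (q * a ^ 2 * α * β * γ * δ) *
        wpSum q a α β γ δ =
      qPochInf q (a * q * α * β) * qPochInf q (a * q * α * γ) * qPochInf q (a * q * α * δ) *
        wpSum q a 0 β γ δ := by
  have hN : ∀ N : ℕ,
      (∏ j ∈ Finset.range N, (1 - α * q * q ^ j)) *
        (∏ j ∈ Finset.range N, (1 - a * α * q * q ^ j)) *
        (∏ j ∈ Finset.range N, (1 - q * a ^ 2 * α * β * γ * δ * q ^ j)) * wpSum q a α β γ δ =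
      (∏ j ∈ Finset.range N, (1 - a * q * α * β * q ^ j)) *
        (∏ j ∈ Finset.range N, (1 - a * q * α * γ * q ^ j)) *
        (∏ j ∈ Finset.range N, (1 - a * q * α * δ * q ^ j)) * wpSum q a (α * q ^ N) β γ δ := by
    intro N
    induction N with
    | zero => simp
    | succ N ih =>
      have hzN : ‖q * a ^ 2 * (α * q ^ N) * β * γ * δ‖ < 1 := by
        have : q * a ^ 2 * (α * q ^ N) * β * γ * δ = q * a ^ 2 * α * β * γ * δ * q ^ N := by ring
        rw [this, norm_mul, norm_pow]
        exact mul_lt_one_of_nonneg_of_lt_one_left (norm_nonneg _) hz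
          (pow_le_one₀ (norm_nonneg _) hq.le)
      have hs := wpSum_step hq0 hq ha (hα.mul_pow N) hβ hγ hδ hzN
      rw [mul_assoc α, ← pow_succ] at hs
      simp only [Finset.prod_range_succ]
      linear_combination (1 - α * q * q ^ N) * (1 - a * α * q * q ^ N) *
        (1 - q * a ^ 2 * α * β * γ * δ * q ^ N) * ih +
        (∏ j ∈ Finset.range N, (1 - a * q * α * β * q ^ j)) *
        (∏ j ∈ Finset.range N, (1 - a * q * α * γ * q ^ j)) *
        (∏ j ∈ Finset.range N, (1 - a * q * α * δ * q ^ j)) * hs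
  have hl := (((tendsto_qPoch_natCast hq (α * q)).mul (tendsto_qPoch_natCast hq (a * α * q))).mul
    (tendsto_qPoch_natCast hq (q * a ^ 2 * α * β * γ * δ))).mul_const (wpSum q a α β γ δ)
  have hr := (((tendsto_qPoch_natCast hq (a * q * α * β)).mul
    (tendsto_qPoch_natCast hq (a * q * α * γ))).mul
    (tendsto_qPoch_natCast hq (a * q * α * δ))).mul (tendsto_wpSum hq0 hq ha hα hβ hγ hδ hz)
  exact tendsto_nhds_unique hl (hr.congr fun N => (hN N).symm)

/-! ### Sending all four parameters to zero -/

theorem qPochInf_zero (q : ℂ) : qPochInf q 0 = 1 := by simp [qPochInf]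

theorem qPochInfs_nil (q : ℂ) (v : Fin 0 → ℂ) : qPochInfs q v = 1 := by simp [qPochInfs]

theorem qPochInfs_cons {m : ℕ} (q x : ℂ) (v : Fin m → ℂ) :
    qPochInfs q (Matrix.vecCons x v) = qPochInf q x * qPochInfs q v := by
  simp [qPochInfs, Fin.prod_univ_succ]

theorem wpSum_rotate (q a α β γ δ : ℂ) : wpSum q a α β γ δ = wpSum q a β γ δ α :=
  tsum_congr fun k => by unfold wpTerm; ring

/-- Each parameter in turn is rotated to the front and sent to `0`. After the first, the convergence
condition is void, since its product is `0`. -/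
theorem wpSum_eq_wpSum_zero {q a α β γ δ : ℂ} (hq0 : q ≠ 0) (hq : ‖q‖ < 1) (ha : a ≠ 0)
    (hα : WpRegular q a α) (hβ : WpRegular q a β) (hγ : WpRegular q a γ) (hδ : WpRegular q a δ)
    (hz : ‖q * a ^ 2 * α * β * γ * δ‖ < 1) :
    (qPochInf q (α * q) * qPochInf q (a * α * q)) * (qPochInf q (β * q) * qPochInf q (a * β * q)) *
        (qPochInf q (γ * q) * qPochInf q (a * γ * q)) *
        (qPochInf q (δ * q) * qPochInf q (a * δ * q)) *
        qPochInf q (q * a ^ 2 * α * β * γ * δ) * wpSum q a α β γ δ =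
      qPochInf q (a * q * α * β) * qPochInf q (a * q * α * γ) * qPochInf q (a * q * α * δ) *
        qPochInf q (a * q * β * γ) * qPochInf q (a * q * β * δ) * qPochInf q (a * q * γ * δ) *
        wpSum q a 0 0 0 0 := by
  have h0 := WpRegular.zero q a
  have h₁ := wpSum_eq_zero_left hq0 hq ha hα hβ hγ hδ hz
  have h₂ := wpSum_eq_zero_left hq0 hq ha hβ hγ hδ h0 (by simp)
  have h₃ := wpSum_eq_zero_left hq0 hq ha hγ hδ h0 h0 (by simp)
  have h₄ := wpSum_eq_zero_left hq0 hq ha hδ h0 h0 h0 (by simp)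
  rw [← wpSum_rotate q a 0 β γ δ] at h₂
  rw [← wpSum_rotate q a 0 γ δ 0] at h₃
  rw [← wpSum_rotate q a 0 δ 0 0] at h₄
  simp only [mul_zero, qPochInf_zero, mul_one, one_mul] at h₂ h₃ h₄
  generalize qPochInf q (a * q * α * β) * qPochInf q (a * q * α * γ) *
    qPochInf q (a * q * α * δ) = B₁ at *
  generalize qPochInf q (α * q) * qPochInf q (a * α * q) = A₁ at *
  generalize qPochInf q (β * q) * qPochInf q (a * β * q) = A₂ at *
  generalize qPochInf q (γ * q) * qPochInf q (a * γ * q) = A₃ at *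
  generalize qPochInf q (δ * q) * qPochInf q (a * δ * q) = A₄ at *
  linear_combination A₂ * A₃ * A₄ * h₁ + B₁ * A₃ * A₄ * h₂ +
    B₁ * (qPochInf q (a * q * β * γ) * qPochInf q (a * q * β * δ)) * A₄ * h₃ +
    B₁ * (qPochInf q (a * q * β * γ) * qPochInf q (a * q * β * δ)) *
      qPochInf q (a * q * γ * δ) * h₄

/-! ### The constant: a triple product evaluation -/

/-- The factor itself is `(-1)^k q^(k(k-1)/2)`; squaring removes the sign and the halved exponent,
and the sum involves only its fourth power. -/
theorem wpFactor_zero_sq {q : ℂ} (hq0 : q ≠ 0) (a : ℂ) (k : ℤ) :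
    wpFactor q a 0 k ^ 2 = q ^ (k * (k - 1)) := by
  have hs : ∀ k : ℤ, wpFactor q a 0 (k + 1) = wpFactor q a 0 k * -q ^ k := fun k => by
    simpa using wpFactor_add_one hq0 (WpRegular.zero q a) k
  induction k with
  | zero => simp [wpFactor_zero]
  | succ n ih =>
    rw [hs, mul_pow, ih, neg_sq, ← zpow_natCast (q ^ (n : ℤ)), ← zpow_mul, ← zpow_add₀ hq0]
    congr 1
    push_cast
    ring
  | pred n ih =>
    have h := hs (-(n : ℤ) - 1)
    rw [sub_add_cancel] at h
    rw [h, mul_pow, neg_sq, ← zpow_natCast (q ^ (-(n : ℤ) - 1)), ← zpow_mul] at ih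
    refine mul_right_cancel₀ (zpow_ne_zero ((-(n : ℤ) - 1) * (2 : ℕ)) hq0) (ih.trans ?_)
    rw [← zpow_add₀ hq0]
    congr 1
    push_cast
    ring

/-- The reflection `k ↦ -m - k` changes the sign of each term. -/
theorem wpSum_zero_of_eq_zpow {q : ℂ} (hq0 : q ≠ 0) (m : ℤ) :
    wpSum q (q ^ m) 0 0 0 0 = 0 := by
  have hT : ∀ k : ℤ, wpTerm q (q ^ m) 0 0 0 0 k =
      q ^ ((1 + 2 * m) * k + 2 * (k * (k - 1))) -
        q ^ (m + 2 * k + ((1 + 2 * m) * k + 2 * (k * (k - 1)))) := fun k => by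
    have e : wpTerm q (q ^ m) 0 0 0 0 k = (1 - q ^ m * (q ^ k) ^ 2) * (q * (q ^ m) ^ 2) ^ k *
        (wpFactor q (q ^ m) 0 k ^ 2) ^ 2 := by unfold wpTerm; ring
    have e1 : q * (q ^ m) ^ 2 = q ^ (1 + 2 * m) := by
      rw [zpow_add₀ hq0, zpow_one, mul_comm 2 m, zpow_mul]; norm_cast
    have e2 : (q ^ k) ^ 2 = q ^ (2 * k) := by rw [mul_comm 2 k, zpow_mul]; norm_cast
    have e3 : (q ^ (k * (k - 1))) ^ 2 = q ^ (2 * (k * (k - 1))) := by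
      rw [mul_comm 2 (k * (k - 1)), zpow_mul _ _ 2]; norm_cast
    rw [e, wpFactor_zero_sq hq0, e1, e2, e3, ← zpow_mul, zpow_add₀ hq0 (m + 2 * k),
      zpow_add₀ hq0 ((1 + 2 * m) * k), zpow_add₀ hq0 m]
    ring
  have hanti : ∀ k : ℤ, wpTerm q (q ^ m) 0 0 0 0 (-m - k) = -wpTerm q (q ^ m) 0 0 0 0 k := by
    intro k
    rw [hT, hT, neg_sub]
    congr 2 <;> ring
  have h : wpSum q (q ^ m) 0 0 0 0 = -wpSum q (q ^ m) 0 0 0 0 := by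
    conv_lhs => rw [wpSum, ← (Equiv.subLeft (-m)).tsum_eq]
    rw [wpSum, ← tsum_neg]
    exact tsum_congr hanti
  exact self_eq_neg.1 h

/-- A form of the Jacobi triple product identity. -/
theorem wpSum_zero {q a : ℂ} (hq0 : q ≠ 0) (hq : ‖q‖ < 1) (ha : a ≠ 0) :
    wpSum q a 0 0 0 0 =
      (1 - a) * (qPochInf q q * qPochInf q (a * q) * qPochInf q (q / a)) := by
  -- The specialisation below may be irregular when `a` is an integer power of `q`. There the sum is
  -- `0`, and on the right a factor vanishes: that of `q / a`, `1 - a` or that of `a q`, as `m` is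
  -- positive, zero or negative.
  by_cases hm : ∃ m : ℤ, a = q ^ m
  · obtain ⟨m, rfl⟩ := hm
    rw [wpSum_zero_of_eq_zpow hq0]
    obtain ⟨n, rfl | rfl⟩ := m.eq_nat_or_neg
    · cases n with
      | zero => simp
      | succ n =>
        have : qPochInf q (q / q ^ ((n + 1 : ℕ) : ℤ)) = 0 := by
          by_contra h
          refine (qPochInf_ne_zero_iff hq).1 h n ?_
          rw [zpow_natCast, pow_succ]
          field_simp
          simp
        rw [this]; simp
    · cases n with
      | zero => simp
      | succ n =>
        have : qPochInf q (q ^ (-((n + 1 : ℕ) : ℤ)) * q) = 0 := by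
          by_contra h
          refine (qPochInf_ne_zero_iff hq).1 h n ?_
          rw [zpow_neg, zpow_natCast, pow_succ]
          field_simp
          simp
        rw [this]; simp
  · push Not at hm
    have hpow : ∀ n : ℕ, 1 - q ^ (n + 1) ≠ 0 := fun n h => by
      have h1 : ‖q ^ (n + 1)‖ < 1 := by
        rw [norm_pow]; exact pow_lt_one₀ (norm_nonneg _) hq (by simp)
      rw [← sub_eq_zero.1 h, norm_one] at h1
      exact lt_irrefl _ h1
    have hα : WpRegular q a a⁻¹ := fun n => by
      refine ⟨fun h => hm (n + 1 : ℕ) ?_, by rw [mul_inv_cancel₀ ha, one_mul]; exact hpow n⟩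
      rw [zpow_natCast]
      field_simp at h
      linear_combination h
    have hβ : WpRegular q a 1 := fun n => by
      refine ⟨by rw [one_mul]; exact hpow n, fun h => hm (-(n + 1 : ℕ)) ?_⟩
      rw [zpow_neg, zpow_natCast]
      rw [mul_one] at h
      exact eq_inv_of_mul_eq_one_left (sub_eq_zero.1 h).symm
    have h0 := WpRegular.zero q a
    -- The `j = 0` numerator vanishes for `β = 1` when `k > 0`, and for `α = 1/a` when `k < 0`.
    have hS : wpSum q a a⁻¹ 1 0 0 = 1 - a := by
      rw [wpSum, tsum_eq_single 0]
      · simp [wpTerm, wpFactor_zero]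
      · intro k hk
        obtain ⟨n, rfl | rfl⟩ := k.eq_nat_or_neg <;> obtain _ | n := n
        · simp at hk
        · have : wpFactor q a 1 ((n + 1 : ℕ) : ℤ) = 0 := by
            rw [wpFactor_natCast, Finset.prod_range_succ']; simp
          rw [wpTerm, this]; simp
        · simp at hk
        · have : wpFactor q a a⁻¹ (-((n + 1 : ℕ) : ℤ)) = 0 := by
            rw [wpFactor_neg_natCast, Finset.prod_range_succ']; simp [ha]
          rw [wpTerm, this]; simp
    have h := wpSum_eq_wpSum_zero hq0 hq ha hα hβ h0 h0 (by simp)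
    have hqq : qPochInf q q ≠ 0 :=
      (qPochInf_ne_zero_iff hq).2 fun n => by rw [← pow_succ']; exact hpow n
    have e1 : a * q * a⁻¹ * 1 = q := by field_simp
    have e2 : a * a⁻¹ * q = q := by field_simp
    rw [hS, e1, e2] at h
    simp only [mul_zero, zero_mul, qPochInf_zero, mul_one, one_mul] at h
    refine mul_left_cancel₀ hqq (h.symm.trans ?_)
    rw [div_eq_inv_mul]
    ring

/-! ### Translation to the `ψ` notation -/

theorem wpRegular_inv {q a u : ℂ} (hu : u ≠ 0) (h₁ : ∀ n : ℕ, u ≠ q ^ (n + 1))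
    (h₂ : ∀ n : ℕ, a * q / u * q ^ n ≠ 1) : WpRegular q a u⁻¹ := fun n => by
  constructor
  · intro h
    apply h₁ n
    field_simp at h
    linear_combination h
  · intro h
    apply h₂ n
    rw [sub_eq_zero.1 h]
    ring

/-- One `u` comes out of each factor; the resulting `u ^ k` cancels against the denominator of the
argument of the series. -/
theorem qPoch_div_qPoch {q a u : ℂ} (hq0 : q ≠ 0) (hu : u ≠ 0) (h : WpRegular q a u⁻¹) (k : ℤ) :
    qPoch q u k / qPoch q (a * q / u) k = wpFactor q a u⁻¹ k * u ^ k := by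
  cases k with
  | ofNat n =>
    have hp : u ^ n = ∏ j ∈ Finset.range n, u := by simp
    rw [Int.ofNat_eq_natCast, wpFactor_natCast, zpow_natCast, hp, ← Finset.prod_mul_distrib]
    refine (Finset.prod_div_distrib _ _).symm.trans (Finset.prod_congr rfl fun j _ => ?_)
    have e₁ : 1 - u * q ^ j = (u⁻¹ - q ^ j) * u := by field_simp
    have e₂ : 1 - a * q / u * q ^ j = 1 - a * u⁻¹ * q ^ (j + 1) := by ring
    rw [e₁, e₂]
    ring
  | negSucc n =>
    have hp : u ^ (Int.negSucc n) = ∏ j ∈ Finset.range (n + 1), u⁻¹ := by simp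
    rw [hp]
    simp only [qPoch, wpFactor]
    rw [← Finset.prod_mul_distrib, inv_div_inv, ← Finset.prod_div_distrib]
    refine Finset.prod_congr rfl fun j _ => ?_
    have e : q ^ (-((j : ℤ) + 1)) = (q ^ (j + 1))⁻¹ := by rw [zpow_neg]; norm_cast
    have hqj : q ^ (j + 1) ≠ 0 := pow_ne_zero _ hq0
    have h1 : u - q ^ (j + 1) ≠ 0 := fun h0 => (h j).1 (by
      rw [← sub_eq_zero.1 h0, inv_mul_cancel₀ hu, sub_self])
    rw [e]
    have e2 : 1 - u * (q ^ (j + 1))⁻¹ = -(u - q ^ (j + 1)) / q ^ (j + 1) := by field_simp; ring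
    have e3 : u⁻¹ * q ^ (j + 1) - 1 = -(u - q ^ (j + 1)) / u := by field_simp; ring
    rw [e2, e3]
    field_simp

/-- Applied to `r = √a` and `r = -√a`, this yields the very-well-poised factor `(1 - a q^(2k)) / (1
- a)`. -/
theorem qPoch_mul_self {q r : ℂ} (hq0 : q ≠ 0) (hq : ‖q‖ < 1) (hr : ∀ m : ℤ, 1 - r * q ^ m ≠ 0)
    (k : ℤ) : qPoch q r k ≠ 0 ∧
      qPoch q (q * r) k * (1 - r) = qPoch q r k * (1 - r * q ^ k) := by
  have hne : ∀ m : ℤ, qPochInf q (r * q ^ m) ≠ 0 := fun m =>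
    (qPochInf_ne_zero_iff hq).2 fun n => by
      rw [mul_assoc, ← zpow_natCast, ← zpow_add₀ hq0]; exact hr _
  have hs : ∀ m : ℤ, qPochInf q (r * q ^ m) = (1 - r * q ^ m) * qPochInf q (r * q ^ (m + 1)) := by
    intro m
    have := qPochInf_split hq (r * q ^ m) 1
    simpa [mul_assoc, zpow_add_one₀ hq0] using this
  have h0 := hs 0
  have n0 := hne 0
  have n1 := hne (0 + 1)
  simp only [zpow_zero, mul_one, zero_add, zpow_one] at h0 n0 n1
  have e : q * r * q ^ k = r * q ^ (k + 1) := by rw [zpow_add_one₀ hq0]; ring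
  rw [qPoch_eq_div hq0 hq r k (hne k),
    qPoch_eq_div hq0 hq (q * r) k (by rw [e]; exact hne _), e, hs k, h0, mul_comm q r]
  have n2 := hne (k + 1)
  have n3 := hr k
  have n4 : 1 - r ≠ 0 := by simpa using hr 0
  refine ⟨div_ne_zero (mul_ne_zero n4 n1) (mul_ne_zero n3 n2), ?_⟩
  field_simp

theorem psiTerm_eq_wpTerm_div {q a r c d e f : ℂ} (hq0 : q ≠ 0) (hq : ‖q‖ < 1) (hr : r ^ 2 = a)
    (hc : c ≠ 0) (hd : d ≠ 0) (he : e ≠ 0) (hf : f ≠ 0)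
    (hr₁ : ∀ m : ℤ, 1 - r * q ^ m ≠ 0) (hr₂ : ∀ m : ℤ, 1 - -r * q ^ m ≠ 0)
    (hc' : WpRegular q a c⁻¹) (hd' : WpRegular q a d⁻¹) (he' : WpRegular q a e⁻¹)
    (hf' : WpRegular q a f⁻¹) (k : ℤ) :
    psiTerm q ![q * r, -q * r, c, d, e, f] ![r, -r, a * q / c, a * q / d, a * q / e, a * q / f]
      (q * a ^ 2 / (c * d * e * f)) k = wpTerm q a c⁻¹ d⁻¹ e⁻¹ f⁻¹ k / (1 - a) := by
  obtain ⟨n₁, h₁⟩ := qPoch_mul_self hq0 hq hr₁ k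
  obtain ⟨n₂, h₂⟩ := qPoch_mul_self hq0 hq hr₂ k
  have m₁ : 1 - r ≠ 0 := by simpa using hr₁ 0
  have m₂ : 1 + r ≠ 0 := by simpa using hr₂ 0
  have ha1 : 1 - a = (1 - r) * (1 + r) := by rw [← hr]; ring
  have hv : qPoch q (q * r) k * qPoch q (-q * r) k / (qPoch q r k * qPoch q (-r) k) =
      (1 - a * (q ^ k) ^ 2) / (1 - a) := by
    rw [neg_mul_comm, ha1, div_eq_div_iff (mul_ne_zero n₁ n₂) (mul_ne_zero m₁ m₂), ← hr]
    linear_combination qPoch q (q * -r) k * (1 + r) * h₁ + qPoch q r k * (1 - r * q ^ k) * h₂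
  have e1 : psiTerm q ![q * r, -q * r, c, d, e, f]
      ![r, -r, a * q / c, a * q / d, a * q / e, a * q / f] (q * a ^ 2 / (c * d * e * f)) k =
      qPoch q (q * r) k * qPoch q (-q * r) k / (qPoch q r k * qPoch q (-r) k) *
      (qPoch q c k / qPoch q (a * q / c) k) * (qPoch q d k / qPoch q (a * q / d) k) *
      (qPoch q e k / qPoch q (a * q / e) k) * (qPoch q f k / qPoch q (a * q / f) k) *
      (q * a ^ 2 / (c * d * e * f)) ^ k := by
    simp only [psiTerm, qPochs, Fin.prod_univ_six, Matrix.cons_val]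
    ring
  rw [e1, hv, qPoch_div_qPoch hq0 hc hc', qPoch_div_qPoch hq0 hd hd', qPoch_div_qPoch hq0 he he',
    qPoch_div_qPoch hq0 hf hf', wpTerm, div_zpow, mul_zpow (c * d * e), mul_zpow (c * d),
    mul_zpow c]
  have := zpow_ne_zero k hc
  have := zpow_ne_zero k hd
  have := zpow_ne_zero k he
  have := zpow_ne_zero k hf
  field_simp

/-- The upper parameter `q r` excludes the nonnegative powers of `q` as values of `r`, the lower
parameter `r` the nonpositive ones. -/
theorem zpow_ne_of_psiWellDefined {q r : ℂ} (hq0 : q ≠ 0) (h₁ : ∀ n : ℕ, q * r ≠ q ^ (n + 1))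
    (h₂ : ∀ n : ℕ, r * q ^ n ≠ 1) (m : ℤ) : 1 - r * q ^ m ≠ 0 := by
  intro h
  obtain ⟨n, rfl | rfl⟩ := m.eq_nat_or_neg
  · exact h₂ n (by rw [← zpow_natCast]; linear_combination -h)
  · apply h₁ n
    have hp : q ^ n ≠ 0 := pow_ne_zero _ hq0
    rw [zpow_neg, zpow_natCast] at h
    field_simp at h
    linear_combination (-q) * h

/-! ### Bailey's sum and the transformation -/

/-- Bailey's very-well-poised `₆ψ₆` summation. -/
theorem bailey_six_psi_six {q a r c d e f : ℂ} (hq0 : q ≠ 0) (hq : ‖q‖ < 1) (ha : a ≠ 0)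
    (hc : c ≠ 0) (hd : d ≠ 0) (he : e ≠ 0) (hf : f ≠ 0) (hr : r ^ 2 = a)
    (hz : ‖q * a ^ 2 / (c * d * e * f)‖ < 1)
    (h : PsiWellDefined q ![q * r, -q * r, c, d, e, f]
      ![r, -r, a * q / c, a * q / d, a * q / e, a * q / f]) :
    Summable (psiTerm q ![q * r, -q * r, c, d, e, f]
      ![r, -r, a * q / c, a * q / d, a * q / e, a * q / f] (q * a ^ 2 / (c * d * e * f))) ∧
    qPochInfs q ![q / c, a * q / c, q / d, a * q / d, q / e, a * q / e, q / f, a * q / f,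
      q * a ^ 2 / (c * d * e * f)] ≠ 0 ∧
    psi q ![q * r, -q * r, c, d, e, f] ![r, -r, a * q / c, a * q / d, a * q / e, a * q / f]
      (q * a ^ 2 / (c * d * e * f)) =
    qPochInfs q ![a * q / (c * d), a * q / (c * e), a * q / (c * f), a * q / (d * e),
      a * q / (d * f), a * q / (e * f), q, a * q, q / a] /
    qPochInfs q ![q / c, a * q / c, q / d, a * q / d, q / e, a * q / e, q / f, a * q / f,
      q * a ^ 2 / (c * d * e * f)] := by
  obtain ⟨hu, hl⟩ := h
  have hr₁ := zpow_ne_of_psiWellDefined hq0 (hu 0) (hl 0)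
  have hr₂ := zpow_ne_of_psiWellDefined hq0 (r := -r)
    (fun n => by rw [← neg_mul_comm]; exact hu 1 n) (hl 1)
  have hc' : WpRegular q a c⁻¹ := wpRegular_inv hc (hu 2) (hl 2)
  have hd' : WpRegular q a d⁻¹ := wpRegular_inv hd (hu 3) (hl 3)
  have he' : WpRegular q a e⁻¹ := wpRegular_inv he (hu 4) (hl 4)
  have hf' : WpRegular q a f⁻¹ := wpRegular_inv hf (hu 5) (hl 5)
  have hz' : q * a ^ 2 * c⁻¹ * d⁻¹ * e⁻¹ * f⁻¹ = q * a ^ 2 / (c * d * e * f) := by field_simp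
  have hzn : ‖q * a ^ 2 * c⁻¹ * d⁻¹ * e⁻¹ * f⁻¹‖ < 1 := by rwa [hz']
  have hT := psiTerm_eq_wpTerm_div hq0 hq hr hc hd he hf hr₁ hr₂ hc' hd' he' hf'
  have hreg : ∀ {u : ℂ}, WpRegular q a u⁻¹ → qPochInf q (q / u) ≠ 0 ∧ qPochInf q (a * q / u) ≠ 0 :=
    fun {u} hu => ⟨(qPochInf_ne_zero_iff hq).2 fun n => by convert (hu n).1 using 2; ring,
      (qPochInf_ne_zero_iff hq).2 fun n => by convert (hu n).2 using 2; ring⟩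
  have hz0 : qPochInf q (q * a ^ 2 / (c * d * e * f)) ≠ 0 :=
    (qPochInf_ne_zero_iff hq).2 fun n h0 => by
      have h1 : ‖q * a ^ 2 / (c * d * e * f) * q ^ n‖ < 1 := by
        rw [norm_mul, norm_pow]
        exact mul_lt_one_of_nonneg_of_lt_one_left (norm_nonneg _) hz
          (pow_le_one₀ (norm_nonneg _) hq.le)
      rw [← sub_eq_zero.1 h0, norm_one] at h1
      exact lt_irrefl _ h1
  have hD : qPochInfs q ![q / c, a * q / c, q / d, a * q / d, q / e, a * q / e, q / f, a * q / f,
      q * a ^ 2 / (c * d * e * f)] ≠ 0 := by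
    simp [qPochInfs_cons, qPochInfs_nil, hreg hc', hreg hd', hreg he', hreg hf', hz0]
  have ha1 : 1 - a ≠ 0 := by
    have m₁ := hr₁ 0
    have m₂ := hr₂ 0
    rw [zpow_zero, mul_one] at m₁ m₂
    have : 1 - a = (1 - r) * (1 - -r) := by rw [← hr]; ring
    rw [this]
    exact mul_ne_zero m₁ m₂
  refine ⟨?_, hD, ?_⟩
  · exact ((summable_wpTerm hq0 hq ha hc' hd' he' hf' hzn).div_const _).congr fun k => (hT k).symm
  · rw [psi, tsum_congr hT, tsum_div_const, div_eq_div_iff ha1 hD]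
    have hs := wpSum_eq_wpSum_zero hq0 hq ha hc' hd' he' hf' hzn
    rw [wpSum_zero hq0 hq ha, hz', wpSum] at hs
    have i₁ : ∀ u : ℂ, u⁻¹ * q = q / u := fun u => by ring
    have i₂ : ∀ u : ℂ, a * u⁻¹ * q = a * q / u := fun u => by ring
    have i₃ : ∀ u v : ℂ, a * q * u⁻¹ * v⁻¹ = a * q / (u * v) := fun u v => by
      rw [div_eq_mul_inv, mul_inv, mul_assoc]
    simp only [i₁, i₂, i₃] at hs
    simp only [qPochInfs_cons, qPochInfs_nil]
    linear_combination hs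

theorem mainTheorem2 (q a b c d e f lam ra rlam : ℂ)
    (hq0 : 0 < ‖q‖) (hq1 : ‖q‖ < 1)
    (ha : a ≠ 0) (hb : b ≠ 0) (hc : c ≠ 0) (hd : d ≠ 0) (he : e ≠ 0) (hf : f ≠ 0)
    (hlam : lam = q * a ^ 2 / (b * c * d))
    -- `ra` and `rlam` are arbitrary square roots of `a` and `lam`
    (hra : ra ^ 2 = a) (hrlam : rlam ^ 2 = lam)
    (hz : ‖q * a ^ 2 / (c * d * e * f)‖ < 1)
    -- no denominator in the two series or in the product factor vanishes
    (hL : PsiWellDefined q ![q * ra, -q * ra, c, d, e, f]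
      ![ra, -ra, a * q / c, a * q / d, a * q / e, a * q / f])
    (hR : PsiWellDefined q ![q * rlam, -q * rlam, lam * c / a, lam * d / a, e, f]
      ![rlam, -rlam, a * q / c, a * q / d, lam * q / e, lam * q / f])
    (hP : qPochInfs q ![a * q / e, a * q / f, q / c, q / d, lam * q, q / lam,
      lam * q / (e * f), b] ≠ 0) :
    Summable (psiTerm q ![q * ra, -q * ra, c, d, e, f]
      ![ra, -ra, a * q / c, a * q / d, a * q / e, a * q / f]
      (q * a ^ 2 / (c * d * e * f))) ∧
    Summable (psiTerm q ![q * rlam, -q * rlam, lam * c / a, lam * d / a, e, f]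
      ![rlam, -rlam, a * q / c, a * q / d, lam * q / e, lam * q / f]
      (q * a ^ 2 / (c * d * e * f))) ∧
    psi q ![q * ra, -q * ra, c, d, e, f]
      ![ra, -ra, a * q / c, a * q / d, a * q / e, a * q / f]
      (q * a ^ 2 / (c * d * e * f)) =
    qPochInfs q ![a * q, q / a, a * q / (e * f), a * q / (c * d), lam * q / e, lam * q / f,
        a * q / (lam * c), a * q / (lam * d)] /
      qPochInfs q ![a * q / e, a * q / f, q / c, q / d, lam * q, q / lam,
        lam * q / (e * f), b] *
    psi q ![q * rlam, -q * rlam, lam * c / a, lam * d / a, e, f]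
      ![rlam, -rlam, a * q / c, a * q / d, lam * q / e, lam * q / f]
      (q * a ^ 2 / (c * d * e * f)) := by
  have hq : q ≠ 0 := norm_pos_iff.1 hq0
  have hl : lam ≠ 0 := by rw [hlam]; positivity
  have hC : lam * c / a ≠ 0 := by positivity
  have hD : lam * d / a ≠ 0 := by positivity
  -- The right-hand series is Bailey's with base `λ` and parameters `λc/a, λd/a, e, f`; these
  -- identities rewrite its data in the stated form.
  have e1 : lam * q / (lam * c / a) = a * q / c := by field_simp
  have e2 : lam * q / (lam * d / a) = a * q / d := by field_simp
  have e3 : q * lam ^ 2 / (lam * c / a * (lam * d / a) * e * f) = q * a ^ 2 / (c * d * e * f) := by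
    field_simp
  have e4 : q / (lam * c / a) = a * q / (lam * c) := by field_simp
  have e5 : q / (lam * d / a) = a * q / (lam * d) := by field_simp
  -- Beyond `λ ≠ 0`, the value of `λ` matters only here: it makes this product parameter equal to
  -- `b`.
  have e6 : lam * q / (lam * c / a * (lam * d / a)) = b := by rw [hlam]; field_simp
  have e7 : lam * q / (lam * c / a * e) = a * q / (c * e) := by field_simp
  have e8 : lam * q / (lam * c / a * f) = a * q / (c * f) := by field_simp
  have e9 : lam * q / (lam * d / a * e) = a * q / (d * e) := by field_simp
  have e10 : lam * q / (lam * d / a * f) = a * q / (d * f) := by field_simp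
  obtain ⟨s₁, n₁, h₁⟩ := bailey_six_psi_six hq hq1 ha hc hd he hf hra hz hL
  obtain ⟨s₂, n₂, h₂⟩ := bailey_six_psi_six hq hq1 hl hC hD he hf hrlam (by rwa [e3])
    (by rwa [e1, e2])
  rw [e1, e2, e3] at s₂ n₂ h₂
  rw [e4, e5] at n₂ h₂
  rw [e6, e7, e8, e9, e10] at h₂
  refine ⟨s₁, s₂, ?_⟩
  -- Cross-multiplied, both sides are the same monomial in the infinite products, so numerator
  -- products may vanish.
  rw [h₁, h₂, div_mul_div_comm, div_eq_div_iff n₁ (mul_ne_zero hP n₂)]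
  simp only [qPochInfs_cons, qPochInfs_nil]
  ring
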